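/- Let $\mathcal H$ be a real Hilbert space. Identify a multi-valued operator $A\colon\mathcal H\rightrightarrows\mathcal H$ with its graph $\{(x,u) : u\in Ax\}$, with sums, scalar multiples, compositions and inverses defined on graphs. For a function $f\colon\mathcal H\to\mathbb R\cup\{\pm\infty\}$ let $\partial f(x)=\{u\in\mathcal H : f(y)\ge f(x)+\langle u,y-x\rangle\ \forall y\in\mathcal H\}$; write $\nabla f=\partial f$ when $\partial f$ is single-valued. For $0\le\mu<L\le\infty$ let $\mathcal F_{\mu,L}$ be the set of convex, closed, proper functions on $\mathcal H$ that are $\mu$-strongly convex (no condition if $\mu=0$) and, if $L<\infty$, $L$-smooth, that is, finite and differentiable on all of $\mathcal H$ with $L$-Lipschitz gradient. For $\alpha>0$ let $J_{\alpha A}=(I+\alpha A)^{-1}$, and for $\alpha,\lambda>0$ define the Davis--Yin splitting operator $$T_{A,B,C,\alpha,\lambda}=I-\lambda J_{\alpha B}+\lambda J_{\alpha A}\bigl(2J_{\alpha B}-I-\alpha C J_{\alpha B}\bigr).$$ An operator $T$ is called $\rho$-Lipschitz if $\|u-v\|\le\rho\|x-y\|$ whenever $u\in Tx$ and $v\in Ty$.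 Theorem 1. Let $f\in\mathcal F_{\mu_f,L_f}$, $g\in\mathcal F_{\mu_g,L_g}$, $h\in\mathcal F_{\mu_h,L_h}$, where $$0\le\mu_f<L_f\le\infty,\qquad 0\le\mu_g<L_g\le\infty,\qquad 0\le\mu_h<L_h<\infty,$$ and let $\alpha>0$, $\lambda>0$. With the convention that $\frac{1}{1+\alpha L}=0$ for $L=\infty$, put $$C_f=\tfrac12\Bigl(\tfrac1{1+\alpha\mu_f}+\tfrac1{1+\alpha L_f}\Bigr),\qquad R_f=\tfrac12\Bigl(\tfrac1{1+\alpha\mu_f}-\tfrac1{1+\alpha L_f}\Bigr),$$ $$C_g=\tfrac12\Bigl(\tfrac1{1+\alpha\mu_g}+\tfrac1{1+\alpha L_g}\Bigr),\qquad R_g=\tfrac12\Bigl(\tfrac1{1+\alpha\mu_g}-\tfrac1{1+\alpha L_g}\Bigr),$$ $$d=\max\{|2-\lambda-\alpha\mu_h|,\ |2-\lambda-\alpha L_h|\}.$$ If $\lambda<1/C_f$, then $T_{\partial f,\partial g,\nabla h,\alpha,\lambda}$ is $\rho_f$-Lipschitz, where $\rho_f\ge0$ and $$\rho_f^2=\Bigl(1-\lambda\tfrac{C_f^2-R_f^2}{C_f}\Bigr)\max\Bigl\{\bigl(1-\tfrac{\lambda}{1+\alpha\mu_g}\bigr)^2+\tfrac{\lambda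 d^2}{1/C_f-\lambda}\bigl(\tfrac1{1+\alpha\mu_g}\bigr)^2,\ \bigl(1-\tfrac{\lambda}{1+\alpha L_g}\bigr)^2+\tfrac{\lambda d^2}{1/C_f-\lambda}\bigl(\tfrac1{1+\alpha L_g}\bigr)^2\Bigr\}.$$ Symmetrically, if $\lambda<1/C_g$, then $T_{\partial f,\partial g,\nabla h,\alpha,\lambda}$ is $\rho_g$-Lipschitz, where $\rho_g\ge0$ and $$\rho_g^2=\Bigl(1-\lambda\tfrac{C_g^2-R_g^2}{C_g}\Bigr)\max\Bigl\{\bigl(1-\tfrac{\lambda}{1+\alpha\mu_f}\bigr)^2+\tfrac{\lambda d^2}{1/C_g-\lambda}\bigl(\tfrac1{1+\alpha\mu_f}\bigr)^2,\ \bigl(1-\tfrac{\lambda}{1+\alpha L_f}\bigr)^2+\tfrac{\lambda d^2}{1/C_g-\lambda}\bigl(\tfrac1{1+\alpha L_f}\bigr)^2\Bigr\}.$$ -/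

import Mathlib

/-- A multi-valued operator `H ⇉ H`, identified with its graph: `(x, u) ∈ A` means `u ∈ A x`.
The identity operator is `SetRel.id` and the inverse operator is `SetRel.inv`. -/
abbrev MultiOp (H : Type*) : Type _ := SetRel H H

namespace MultiOp

/-- The composition `A B` of operators: first `B`, then `A`. -/
def after {H : Type*} (A B : MultiOp H) : MultiOp H := SetRel.comp B A

/-- The sum `{(x, u + v) | (x, u) ∈ A, (x, v) ∈ B}`. -/
def sum {H : Type*} [AddCommGroup H] (A B : MultiOp H) : MultiOp H :=
  {p | ∃ u v, (p.1, u) ∈ A ∧ (p.1, v) ∈ B ∧ p.2 = u + v}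

/-- The scalar multiple `{(x, c u) | (x, u) ∈ A}`. -/
def scale {H : Type*} [AddCommGroup H] [Module ℝ H] (c : ℝ) (A : MultiOp H) : MultiOp H :=
  {p | ∃ u, (p.1, u) ∈ A ∧ p.2 = c • u}

/-- The resolvent `(I + α A)⁻¹`. -/
def resolvent {H : Type*} [AddCommGroup H] [Module ℝ H] (α : ℝ) (A : MultiOp H) : MultiOp H :=
  SetRel.inv (sum SetRel.id (scale α A))

/-- The Davis--Yin splitting operator
`I - lam J_B + lam J_A (2 J_B - I - α C J_B)`, where `J_A`, `J_B` are the resolvents of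
`A`, `B` with step size `α`. -/
def dys {H : Type*} [AddCommGroup H] [Module ℝ H] (A B C : MultiOp H) (α lam : ℝ) : MultiOp H :=
  sum (sum SetRel.id (scale (-lam) (resolvent α B)))
    (scale lam (after (resolvent α A)
      (sum (sum (scale 2 (resolvent α B)) (scale (-1) SetRel.id))
        (scale (-α) (after C (resolvent α B))))))

/-- `A` is `ρ`-Lipschitz: `‖u - v‖ ≤ ρ ‖x - y‖` for all `u ∈ A x` and `v ∈ A y`.
(For `x = y` this says that `A` is single-valued on its domain.) -/
def IsLipschitz {H : Type*} [NormedAddCommGroup H] (ρ : ℝ) (A : MultiOp H) : Prop :=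
  ∀ x y u v : H, (x, u) ∈ A → (y, v) ∈ A → ‖u - v‖ ≤ ρ * ‖x - y‖

end MultiOp

/-- The subdifferential of an extended real-valued function:
`g ∈ ∂f(x)` iff `f y ≥ f x + ⟨g, y - x⟩` for all `y`. -/
def subdifferential {H : Type*} [NormedAddCommGroup H] [InnerProductSpace ℝ H]
    (f : H → EReal) : MultiOp H :=
  {p | ∀ y : H, f p.1 + ((inner ℝ p.2 (y - p.1) : ℝ) : EReal) ≤ f y}

/-- The epigraph of an extended real-valued function, as a subset of `H × ℝ`. -/
def epigraphE {H : Type*} (f : H → EReal) : Set (H × ℝ) := {p | f p.1 ≤ (p.2 : EReal)}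

/-- Convex, closed and proper extended real-valued functions. -/
structure IsCCP {H : Type*} [NormedAddCommGroup H] [InnerProductSpace ℝ H]
    (f : H → EReal) : Prop where
  convex : Convex ℝ (epigraphE f)
  closed : IsClosed (epigraphE f)
  ne_bot : ∀ x, f x ≠ ⊥
  exists_ne_top : ∃ x, f x ≠ ⊤

/-- `μ`-strong convexity:
`f (a x + b y) ≤ a f x + b f y - a b (μ / 2) ‖x - y‖²` for `a, b ≥ 0`, `a + b = 1`.
The values `f x`, `f y` are replaced by arbitrary real upper bounds `s`, `t`, which gives the same
condition and avoids arithmetic with infinite values. -/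
def IsStronglyConvexE {H : Type*} [NormedAddCommGroup H] [InnerProductSpace ℝ H]
    (μ : ℝ) (f : H → EReal) : Prop :=
  ∀ (x y : H) (s t a b : ℝ), f x ≤ (s : EReal) → f y ≤ (t : EReal) →
    0 ≤ a → 0 ≤ b → a + b = 1 →
      f (a • x + b • y) ≤ ((a * s + b * t - a * b * (μ / 2) * ‖x - y‖ ^ 2 : ℝ) : EReal)

/-- `L`-smoothness: `f` is finite and differentiable on the whole space and its gradient is
`L`-Lipschitz. -/
def IsSmoothE {H : Type*} [NormedAddCommGroup H] [InnerProductSpace ℝ H] [CompleteSpace H]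
    (L : ℝ) (f : H → EReal) : Prop :=
  ∃ φ : H → ℝ, (∀ x, f x = (φ x : EReal)) ∧ Differentiable ℝ φ ∧
    ∀ x y, ‖gradient φ x - gradient φ y‖ ≤ L * ‖x - y‖

/-- The class of convex, closed, proper functions on `H` that are `μ`-strongly convex (no
condition if `μ = 0`) and `L`-smooth (no condition if `L = ∞`). Meant for `0 ≤ μ < L ≤ ∞`. -/
def functionClass (H : Type*) [NormedAddCommGroup H] [InnerProductSpace ℝ H] [CompleteSpace H]
    (μ : ℝ) (L : EReal) : Set (H → EReal) :=
  {f | IsCCP f ∧ (0 < μ → IsStronglyConvexE μ f) ∧ (L ≠ ⊤ → IsSmoothE L.toReal f)}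

open Classical in
/-- `1 / (1 + α L)` for `L ∈ (0, ∞]`, with the convention `1 / ∞ = 0`. -/
noncomputable def invOneAdd (α : ℝ) (L : EReal) : ℝ :=
  if L = ⊤ then 0 else 1 / (1 + α * L.toReal)

/-!
The argument reduces the claim to inequalities between differences of points. Say that `(z, a)` lies
in the sector `[q, p]` if `⟨a - p z, a - q z⟩ ≤ 0`, that is, if `a` lies in the ball with centre
`((p + q) / 2) z` and radius `(|p - q| / 2) ‖z‖`. By the interpolation inequality for
`μ`-strongly convex, `L`-smooth functions, differences of points and subgradients lie in the sector
`[μ, L]`, hence differences of arguments and values of the resolvent lie in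
`[1 / (1 + α L), 1 / (1 + α μ)]` (`functionClass.inSector_resolvent`). With `x`, `b`, `c`, `a` the
differences of the arguments, of the values of `J_g`, of `∇h` and of `J_f`, the difference of the
values of the Davis--Yin operator is `w + lam a` with `w = x - lam b`. Here `a` is attached to
`s - w`, where `s = (2 - lam) b - α c` satisfies `‖s‖ ≤ d ‖b‖`
(`functionClass.exists_inSector_of_mem_dys`).

For the first rate, the triangle inequality for the ball of `a` gives
`‖w + lam a‖ ≤ ‖(1 - lam C_f) w + lam C_f s‖ + lam R_f ‖s - w‖`, and the Cauchy--Schwarz inequality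
with the variance identity bounds the square by a multiple of a weighted sum of `‖w‖ ^ 2` and
`‖s‖ ^ 2` (`norm_add_smul_sq_le`). What remains, `‖x - lam b‖ ^ 2 + k ‖b‖ ^ 2`, is at most an
affine function of `⟨x, b⟩`, and so is maximal at an endpoint of the sector
(`norm_sub_smul_sq_add_le`).

The second rate follows from the first one by duality (`norm_sq_le_rateSq_swap`). Each pair in a
sector is realised by a symmetric operator whose graph stays in the sector
(`InSector.exists_symmetric`), so the difference of the values is `T x` for
`T = (1 - lam A) (1 - lam B) + lam A S B`. The adjoint of `T` has the same form with `A` and `B`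
exchanged, and the same norm.
-/

section

variable {H : Type*} [NormedAddCommGroup H] [InnerProductSpace ℝ H]

/-! ### Sectors -/

/-- The pair `(z, a)` lies in the sector with endpoints `p` and `q`, whose order is immaterial:
`⟨a - p z, a - q z⟩ ≤ 0`. Equivalently, `a` lies in the ball with centre `((p + q) / 2) z` and
radius `(|p - q| / 2) ‖z‖`. -/
def InSector (p q : ℝ) (z a : H) : Prop := inner ℝ (a - p • z) (a - q • z) ≤ 0

namespace InSector

theorem inner_eq (p q : ℝ) (z a : H) :
    inner ℝ (a - p • z) (a - q • z) =
      ‖a - ((p + q) / 2) • z‖ ^ 2 - (|p - q| / 2 * ‖z‖) ^ 2 := by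
  rw [mul_pow, div_pow, sq_abs, ← real_inner_self_eq_norm_sq, ← real_inner_self_eq_norm_sq]
  simp only [inner_sub_left, inner_sub_right, real_inner_smul_left, real_inner_smul_right,
    real_inner_comm z a]
  ring

theorem iff_norm_le {p q : ℝ} {z a : H} :
    InSector p q z a ↔ ‖a - ((p + q) / 2) • z‖ ≤ |p - q| / 2 * ‖z‖ := by
  rw [InSector, inner_eq, sub_nonpos]
  exact pow_le_pow_iff_left₀ (norm_nonneg _) (by positivity) two_ne_zero

theorem neg_iff {d : ℝ} (hd : 0 ≤ d) {b s : H} : InSector d (-d) b s ↔ ‖s‖ ≤ d * ‖b‖ := by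
  rw [iff_norm_le]
  have h : |d - -d| / 2 = d := by rw [sub_neg_eq_add, abs_of_nonneg (by linarith)]; ring
  rw [h, add_neg_cancel, zero_div, zero_smul, sub_zero]

theorem eq_zero {p q : ℝ} {a : H} (h : InSector p q 0 a) : a = 0 := by
  simpa using iff_norm_le.1 h

theorem inner_eq_quadratic (p q : ℝ) (z a : H) :
    inner ℝ (a - p • z) (a - q • z) =
      ‖a‖ ^ 2 - (p + q) * inner ℝ z a + p * q * ‖z‖ ^ 2 := by
  rw [← real_inner_self_eq_norm_sq, ← real_inner_self_eq_norm_sq]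
  simp only [inner_sub_left, inner_sub_right, real_inner_smul_left, real_inner_smul_right,
    real_inner_comm z a]
  ring

theorem smul_sub_smul {μ L α t : ℝ} (hμL : μ ≤ L) (hα : 0 < α) {b c : H}
    (h : InSector μ L b c) :
    InSector (max |t - α * μ| |t - α * L|) (-max |t - α * μ| |t - α * L|) b
      (t • b - α • c) := by
  rw [neg_iff (le_max_of_le_left (abs_nonneg _))]
  rw [iff_norm_le, abs_sub_comm, abs_of_nonneg (sub_nonneg.2 hμL)] at h
  have e : t • b - α • c =
      (t - α * ((μ + L) / 2)) • b - α • (c - ((μ + L) / 2) • b) := by module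
  have h1 : ‖t • b - α • c‖ ≤
      |t - α * ((μ + L) / 2)| * ‖b‖ + α * ((L - μ) / 2 * ‖b‖) := by
    rw [e]
    refine (norm_sub_le _ _).trans ?_
    rw [norm_smul, norm_smul, Real.norm_of_nonneg hα.le, Real.norm_eq_abs]
    gcongr
  have h2 : |t - α * ((μ + L) / 2)| + α * ((L - μ) / 2) ≤ max |t - α * μ| |t - α * L| := by
    rcases abs_cases (t - α * ((μ + L) / 2)) with ⟨h, -⟩ | ⟨h, -⟩ <;> rw [h]
    · exact le_max_of_le_left (le_trans (by linarith) (le_abs_self _))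
    · exact le_max_of_le_right (le_trans (by linarith) (neg_le_abs _))
  have h3 := mul_le_mul_of_nonneg_right h2 (norm_nonneg b)
  linarith

/-- Each pair in a sector is realised by a symmetric operator whose graph stays in the sector.
Up to the central multiple of the identity, the operator is a scaled reflection. -/
theorem exists_symmetric {p q : ℝ} {z a : H} (h : InSector p q z a) :
    ∃ A : H →ₗ[ℝ] H, A.IsSymmetric ∧ A z = a ∧ ∀ y, InSector p q y (A y) := by
  rw [iff_norm_le] at h
  set c := (p + q) / 2
  set v := a - c • z with hv
  suffices ∃ S : H →ₗ[ℝ] H, S.IsSymmetric ∧ S z = v ∧ ∀ y, ‖S y‖ ≤ |p - q| / 2 * ‖y‖ by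
    obtain ⟨S, hS, hz, hb⟩ := this
    refine ⟨c • LinearMap.id + S, fun x y ↦ ?_, by simp [hz, hv], fun y ↦ ?_⟩
    · simp [inner_add_left, inner_add_right, real_inner_smul_left, real_inner_smul_right, hS x y]
    · rw [iff_norm_le]
      simpa [c] using hb y
  by_cases hv0 : v = 0
  · exact ⟨0, fun x y ↦ by simp, by simp [hv0], fun y ↦ by simp; positivity⟩
  have hvn : 0 < ‖v‖ := norm_pos_iff.2 hv0
  have hzn : 0 < ‖z‖ := by
    rcases (norm_nonneg z).eq_or_lt with h0 | h0
    · rw [← h0, mul_zero] at h; linarith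
    · exact h0
  set k := ‖v‖ / ‖z‖ with hk
  have hk0 : 0 < k := by positivity
  set U := (Submodule.span ℝ {z - k⁻¹ • v})ᗮ
  have hzv : U.reflection z = k⁻¹ • v := by
    apply Submodule.reflection_sub
    rw [norm_smul, norm_inv, Real.norm_of_nonneg hk0.le, hk]
    field_simp
  refine ⟨k • (U.reflection.toLinearEquiv : H →ₗ[ℝ] H), fun x y ↦ ?_, ?_, fun y ↦ ?_⟩
  · have : inner ℝ (U.reflection x) y = inner ℝ x (U.reflection y) := by
      rw [← U.reflection.inner_map_map, Submodule.reflection_reflection]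
    simp [real_inner_smul_left, real_inner_smul_right, this]
  · simp [hzv, hk0.ne']
  · simp only [LinearMap.smul_apply, LinearEquiv.coe_coe, LinearIsometryEquiv.coe_toLinearEquiv,
      norm_smul, LinearIsometryEquiv.norm_map, Real.norm_of_nonneg hk0.le]
    gcongr
    rw [hk, div_le_iff₀ hzn]
    exact h

end InSector

/-! ### The norm bounds -/

theorem norm_add_smul_sq_le {p q C lam : ℝ} {w s a : H} (hC : C = (p + q) / 2) (hC0 : 0 < C)
    (hlam : 0 < lam) (hlC : lam < 1 / C) (ha : InSector p q (s - w) a) :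
    ‖w + lam • a‖ ^ 2 ≤
      (1 - lam * (p * q / C)) * (‖w‖ ^ 2 + lam / (1 / C - lam) * ‖s‖ ^ 2) := by
  rw [InSector.iff_norm_le, ← hC] at ha
  have hc1 : lam * C < 1 := by rwa [lt_div_iff₀ hC0] at hlC
  set c := lam * C with hc
  have hc0 : 0 < c := by positivity
  set r := lam * (|p - q| / 2) with hr
  have hr2 : r ^ 2 = c ^ 2 - lam ^ 2 * (p * q) := by
    rw [hr, hc, mul_pow, div_pow, sq_abs, hC]; ring
  set P := ‖(1 - c) • w + c • s‖ with hP
  set D := ‖s - w‖ with hD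
  have hle : ‖w + lam • a‖ ≤ P + r * D := by
    have : w + lam • a = ((1 - c) • w + c • s) + lam • (a - C • (s - w)) := by
      rw [hc]; module
    rw [this]
    refine (norm_add_le _ _).trans ?_
    rw [norm_smul, Real.norm_of_nonneg hlam.le, hr, mul_assoc]
    gcongr
  -- the variance identity for the weights `1 - c`, `c`
  have hid : (1 - c) * ‖w‖ ^ 2 + c * ‖s‖ ^ 2 = P ^ 2 + c * (1 - c) * D ^ 2 := by
    simp only [hP, hD, ← real_inner_self_eq_norm_sq, inner_add_left, inner_add_right,
      inner_sub_left, inner_sub_right, real_inner_smul_left, real_inner_smul_right,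
      real_inner_comm w s]
    ring
  have h1c : (1 - c) ≠ 0 := by linarith
  have he : 0 < c * (1 - c) := mul_pos hc0 (by linarith)
  have hcs : (P + r * D) ^ 2 ≤ (1 + r ^ 2 / (c * (1 - c))) * (P ^ 2 + c * (1 - c) * D ^ 2) := by
    have : (1 + r ^ 2 / (c * (1 - c))) * (P ^ 2 + c * (1 - c) * D ^ 2) - (P + r * D) ^ 2 =
        (c * (1 - c) * D - r * P) ^ 2 / (c * (1 - c)) := by
      field_simp
      ring
    have h2 : 0 ≤ (c * (1 - c) * D - r * P) ^ 2 / (c * (1 - c)) := by positivity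
    linarith
  have h1c' : (1 / C - lam) ≠ 0 := by linarith
  have hK : 1 - lam * (p * q / C) = (1 + r ^ 2 / (c * (1 - c))) * (1 - c) := by
    rw [hr2]; field_simp; rw [hc]; ring
  have hm : lam / (1 / C - lam) = c / (1 - c) := by
    rw [div_eq_div_iff h1c' h1c, hc]; field_simp
  calc ‖w + lam • a‖ ^ 2 ≤ (P + r * D) ^ 2 := by gcongr
    _ ≤ _ := hcs
    _ = _ := by
      rw [← hid, hK, hm, mul_assoc]
      field_simp

theorem norm_sub_smul_sq_add_le {p q lam k : ℝ} (hqp : q ≤ p) (hk : 0 ≤ k) {x b : H}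
    (hb : InSector p q x b) :
    ‖x - lam • b‖ ^ 2 + k * ‖b‖ ^ 2 ≤
      max ((1 - lam * p) ^ 2 + k * p ^ 2) ((1 - lam * q) ^ 2 + k * q ^ 2) * ‖x‖ ^ 2 := by
  rcases eq_or_ne x 0 with rfl | hx
  · simp [hb.eq_zero]
  rw [InSector, InSector.inner_eq_quadratic] at hb
  have hN : 0 < ‖x‖ ^ 2 := by positivity
  have hcs : inner ℝ x b ^ 2 ≤ ‖x‖ ^ 2 * ‖b‖ ^ 2 := by
    rw [← mul_pow]; exact sq_le_sq' (by linarith [neg_le_of_abs_le (abs_real_inner_le_norm x b)])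
      (real_inner_le_norm x b)
  have hex : ‖x - lam • b‖ ^ 2 = ‖x‖ ^ 2 - 2 * lam * inner ℝ x b + lam ^ 2 * ‖b‖ ^ 2 := by
    rw [norm_sub_sq_real, real_inner_smul_right, norm_smul, mul_pow, Real.norm_eq_abs, sq_abs]
    ring
  rw [hex]
  generalize ‖x‖ ^ 2 = N at *
  generalize ‖b‖ ^ 2 = B at *
  generalize inner ℝ x b = I at *
  have hprod : (I - p * N) * (I - q * N) ≤ 0 := by nlinarith
  have hqN : q * N ≤ p * N := by gcongr
  have hI1 : I ≤ p * N := by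
    by_contra! hcon
    have := mul_pos (sub_pos.2 hcon) (sub_pos.2 (hqN.trans_lt hcon))
    linarith
  have hI2 : q * N ≤ I := by
    by_contra! hcon
    have := mul_pos_of_neg_of_neg (sub_neg.2 (hcon.trans_le hqN)) (sub_neg.2 hcon)
    linarith
  have hB : (lam ^ 2 + k) * B ≤ (lam ^ 2 + k) * ((p + q) * I - p * q * N) := by
    gcongr; linarith
  -- the remaining bound is affine in `I`, which lies between `q * N` and `p * N`
  rcases le_total 0 ((lam ^ 2 + k) * (p + q) - 2 * lam) with hs | hs
  · have h1 := mul_le_mul_of_nonneg_left hI1 hs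
    have h2 := mul_le_mul_of_nonneg_right
      (le_max_left ((1 - lam * p) ^ 2 + k * p ^ 2) ((1 - lam * q) ^ 2 + k * q ^ 2)) hN.le
    linarith
  · have h1 := mul_le_mul_of_nonpos_left hI2 hs
    have h2 := mul_le_mul_of_nonneg_right
      (le_max_right ((1 - lam * p) ^ 2 + k * p ^ 2) ((1 - lam * q) ^ 2 + k * q ^ 2)) hN.le
    linarith

/-- The square of the Lipschitz constant obtained from the sectors `[q, p]` and `[q', p']` of the
outer and the inner resolvent. -/
noncomputable def rateSq (p q p' q' d lam : ℝ) : ℝ :=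
  (1 - lam * (p * q / ((p + q) / 2))) *
    max ((1 - lam * p') ^ 2 + lam * d ^ 2 / (1 / ((p + q) / 2) - lam) * p' ^ 2)
      ((1 - lam * q') ^ 2 + lam * d ^ 2 / (1 / ((p + q) / 2) - lam) * q' ^ 2)

section Composition

variable {p q p' q' d lam : ℝ}

theorem one_sub_mul_div_nonneg (hpq : 0 < p + q) (hlam : 0 < lam)
    (hl : lam < 1 / ((p + q) / 2)) : 0 ≤ 1 - lam * (p * q / ((p + q) / 2)) := by
  have h1 : lam * ((p + q) / 2) < 1 := by rwa [lt_div_iff₀ (by linarith)] at hl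
  have h2 : p * q / ((p + q) / 2) ≤ (p + q) / 2 := by
    rw [div_le_iff₀ (by linarith)]
    nlinarith [sq_nonneg (p - q)]
  nlinarith

theorem rateSq_nonneg (hpq : 0 < p + q) (hlam : 0 < lam) (hl : lam < 1 / ((p + q) / 2)) :
    0 ≤ rateSq p q p' q' d lam := by
  have : 0 < 1 / ((p + q) / 2) - lam := by linarith
  refine mul_nonneg (one_sub_mul_div_nonneg hpq hlam hl) (le_max_of_le_left ?_)
  positivity

theorem norm_sq_le_rateSq (hpq : 0 < p + q) (hqp' : q' ≤ p') (hd : 0 ≤ d) (hlam : 0 < lam)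
    (hl : lam < 1 / ((p + q) / 2)) {x b s a : H} (hb : InSector p' q' x b)
    (hs : InSector d (-d) b s) (ha : InSector p q (s - (x - lam • b)) a) :
    ‖(x - lam • b) + lam • a‖ ^ 2 ≤ rateSq p q p' q' d lam * ‖x‖ ^ 2 := by
  have hm : 0 < 1 / ((p + q) / 2) - lam := by linarith
  have hs' : ‖s‖ ^ 2 ≤ d ^ 2 * ‖b‖ ^ 2 := by
    rw [← mul_pow]
    have := (InSector.neg_iff hd).1 hs
    gcongr
  refine (norm_add_smul_sq_le rfl (by linarith) hlam hl ha).trans ?_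
  rw [rateSq, mul_assoc]
  refine mul_le_mul_of_nonneg_left ?_ (one_sub_mul_div_nonneg hpq hlam hl)
  refine le_trans ?_ (norm_sub_smul_sq_add_le hqp' (by positivity) hb)
  have : lam / (1 / ((p + q) / 2) - lam) * ‖s‖ ^ 2 ≤
      lam / (1 / ((p + q) / 2) - lam) * (d ^ 2 * ‖b‖ ^ 2) := by gcongr
  have h2 : lam / (1 / ((p + q) / 2) - lam) * (d ^ 2 * ‖b‖ ^ 2) =
      lam * d ^ 2 / (1 / ((p + q) / 2) - lam) * ‖b‖ ^ 2 := by ring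
  linarith

/-- The bound of `norm_sq_le_rateSq` with the roles of the two sectors in the rate exchanged. After
realising the pairs by symmetric operators `A`, `B`, `S`, the left-hand vector is `T x` for
`T = (1 - lam A) (1 - lam B) + lam A S B`, and the adjoint of `T` has the same form with `A` and
`B` exchanged. -/
theorem norm_sq_le_rateSq_swap (hqp : q ≤ p) (hpq' : 0 < p' + q') (hd : 0 ≤ d)
    (hlam : 0 < lam) (hl : lam < 1 / ((p' + q') / 2)) {x b s a : H} (hb : InSector p' q' x b)
    (hs : InSector d (-d) b s) (ha : InSector p q (s - (x - lam • b)) a) :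
    ‖(x - lam • b) + lam • a‖ ^ 2 ≤ rateSq p' q' p q d lam * ‖x‖ ^ 2 := by
  obtain ⟨A, hA, hAz, hAs⟩ := ha.exists_symmetric
  obtain ⟨B, hB, hBx, hBs⟩ := hb.exists_symmetric
  obtain ⟨S, hS, hSb, hSs⟩ := hs.exists_symmetric
  set u := (x - lam • b) + lam • a with hu
  set w := (u - lam • A u) + lam • B (S (A u) - (u - lam • A u)) with hw
  have hdual : ‖u‖ ^ 2 = inner ℝ x w := by
    have e : ‖u‖ ^ 2 =
        inner ℝ x u - lam * inner ℝ x (B u) + lam * inner ℝ x (B (S (A u)))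
          - lam * inner ℝ x (A u) + lam * lam * inner ℝ x (B (A u)) := by
      rw [← real_inner_self_eq_norm_sq]
      nth_rewrite 1 [hu]
      rw [← hAz, ← hSb, ← hBx]
      simp only [map_sub, map_smul, inner_add_left, inner_sub_left, real_inner_smul_left, hA _ _,
        hB _ _, hS _ _, smul_sub]
      ring
    rw [e, hw]
    simp only [map_sub, map_smul, inner_add_right, inner_sub_right, real_inner_smul_right]
    ring
  have hwle : ‖w‖ ^ 2 ≤ rateSq p' q' p q d lam * ‖u‖ ^ 2 :=
    norm_sq_le_rateSq hpq' hqp hd hlam hl (hAs u) (hSs (A u)) (hBs _)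
  rcases eq_or_ne u 0 with h0 | h0
  · rw [h0, norm_zero, zero_pow two_ne_zero]
    exact mul_nonneg (rateSq_nonneg hpq' hlam hl) (sq_nonneg _)
  have hun : 0 < ‖u‖ ^ 2 := by positivity
  have hcs : (‖u‖ ^ 2) ^ 2 ≤ ‖x‖ ^ 2 * ‖w‖ ^ 2 := by
    rw [← mul_pow]
    exact pow_le_pow_left₀ (by positivity) (hdual ▸ real_inner_le_norm x w) 2
  have : ‖u‖ ^ 2 * ‖u‖ ^ 2 ≤ (rateSq p' q' p q d lam * ‖x‖ ^ 2) * ‖u‖ ^ 2 := by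
    have := mul_le_mul_of_nonneg_left hwle (sq_nonneg ‖x‖)
    linarith
  exact le_of_mul_le_mul_right this hun

end Composition

/-! ### Resolvents and the Davis--Yin operator -/

theorem MultiOp.mem_resolvent {α : ℝ} {A : MultiOp H} {z a : H} :
    (z, a) ∈ MultiOp.resolvent α A ↔ ∃ u, (a, u) ∈ A ∧ z = a + α • u := by
  constructor
  · rintro ⟨_, _, rfl, ⟨u, hu, rfl⟩, hz⟩
    exact ⟨u, hu, hz⟩
  · rintro ⟨u, hu, hz⟩
    exact ⟨a, α • u, rfl, ⟨u, hu, rfl⟩, hz⟩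

/-- An element of the Davis--Yin operator, when the inner resolvent is single-valued. -/
theorem MultiOp.exists_of_mem_dys {A B C : MultiOp H} {α lam : ℝ}
    (hB : ∀ x b b', (x, b) ∈ resolvent α B → (x, b') ∈ resolvent α B → b = b') {x u : H}
    (hu : (x, u) ∈ dys A B C α lam) :
    ∃ b c a, (x, b) ∈ resolvent α B ∧ (b, c) ∈ C ∧
      ((2 : ℝ) • b - x - α • c, a) ∈ resolvent α A ∧ u = x - lam • b + lam • a := by
  obtain ⟨_, _, ⟨x₁, _, hx₁, ⟨b, hb, rfl⟩, rfl⟩,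
    ⟨a, ⟨z, ⟨_, _, ⟨_, _, ⟨b', hb', rfl⟩, ⟨x₂, hx₂, rfl⟩, h₂⟩,
      ⟨c, ⟨b'', hb'', hc⟩, rfl⟩, hz⟩, ha⟩, rfl⟩, hu⟩ := hu
  obtain rfl : x = x₁ := hx₁
  obtain rfl : x = x₂ := hx₂
  obtain rfl := hB _ _ _ hb hb'
  obtain rfl := hB _ _ _ hb hb''
  refine ⟨b, c, a, hb, hc, ?_, ?_⟩
  · convert ha using 2
    dsimp only at h₂ hz
    rw [hz, h₂]
    module
  · dsimp only at hu
    rw [hu]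
    module

theorem MultiOp.exists_isLipschitz_of_sq_le {E : Type*} [NormedAddCommGroup E] {T : MultiOp E}
    {r : ℝ} (hr : 0 ≤ r)
    (h : ∀ x y u v, (x, u) ∈ T → (y, v) ∈ T → ‖u - v‖ ^ 2 ≤ r * ‖x - y‖ ^ 2) :
    ∃ ρ : ℝ, 0 ≤ ρ ∧ ρ ^ 2 = r ∧ IsLipschitz ρ T := by
  refine ⟨√r, Real.sqrt_nonneg r, Real.sq_sqrt hr, fun x y u v hu hv ↦ ?_⟩
  refine le_of_sq_le_sq ?_ (by positivity)
  rw [mul_pow, Real.sq_sqrt hr]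
  exact h x y u v hu hv

/-! ### Subdifferentials of strongly convex and smooth functions -/

theorem IsCCP.exists_real {f : H → EReal} (hf : IsCCP f) {x u : H}
    (hu : (x, u) ∈ subdifferential f) : ∃ r : ℝ, f x = r := by
  obtain ⟨y, hy⟩ := hf.exists_ne_top
  have htop : f x ≠ ⊤ := by
    intro h
    have := hu y
    rw [h, EReal.top_add_coe, top_le_iff] at this
    exact hy this
  exact ⟨(f x).toReal, (EReal.coe_toReal htop (hf.ne_bot x)).symm⟩

/-- The subgradient inequality of a strongly convex function has an extra quadratic term. -/
theorem IsStronglyConvexE.add_inner_add_le {f : H → EReal} {μ : ℝ} (hf : IsStronglyConvexE μ f)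
    {x y u : H} (hu : (x, u) ∈ subdifferential f) {r s : ℝ} (hr : f x = r) (hs : f y = s) :
    r + inner ℝ u (y - x) + μ / 2 * ‖x - y‖ ^ 2 ≤ s := by
  -- the inequality with the factor `1 - t` follows by dividing by `t`; then let `t → 0`
  have key : ∀ t ∈ Set.Ioo (0 : ℝ) 1,
      r + inner ℝ u (y - x) + (1 - t) * (μ / 2 * ‖x - y‖ ^ 2) ≤ s := by
    intro t ht
    have h1 := (hu ((1 - t) • x + t • y)).trans
      (hf x y r s (1 - t) t hr.le hs.le (by linarith [ht.2]) ht.1.le (by ring))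
    have e : (1 - t) • x + t • y - x = t • (y - x) := by module
    simp only [hr, e, real_inner_smul_right] at h1
    norm_cast at h1
    have h2 : t * (r + inner ℝ u (y - x) + (1 - t) * (μ / 2 * ‖x - y‖ ^ 2)) ≤ t * s := by
      linarith
    exact le_of_mul_le_mul_left h2 ht.1
  have hcont : Filter.Tendsto
      (fun t : ℝ ↦ r + inner ℝ u (y - x) + (1 - t) * (μ / 2 * ‖x - y‖ ^ 2))
      (nhdsWithin 0 (Set.Ioi 0))
      (nhds (r + inner ℝ u (y - x) + (1 - 0) * (μ / 2 * ‖x - y‖ ^ 2))) := by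
    apply ContinuousAt.tendsto ?_ |>.mono_left nhdsWithin_le_nhds
    fun_prop
  have := le_of_tendsto hcont
    (Filter.eventually_of_mem (Ioo_mem_nhdsGT (zero_lt_one' ℝ)) key)
  simpa using this

variable [CompleteSpace H]

theorem functionClass.add_inner_add_le {f : H → EReal} {μ : ℝ} {L : EReal} (hμ : 0 ≤ μ)
    (hf : f ∈ functionClass H μ L) {x y u : H} (hu : (x, u) ∈ subdifferential f) {r s : ℝ}
    (hr : f x = r) (hs : f y = s) :
    r + inner ℝ u (y - x) + μ / 2 * ‖x - y‖ ^ 2 ≤ s := by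
  rcases hμ.eq_or_lt with rfl | hpos
  · have h := hu y
    simp only [hr, hs] at h
    norm_cast at h
    simpa using h
  · exact (hf.2.1 hpos).add_inner_add_le hu hr hs

theorem functionClass.mul_norm_sq_le_inner {f : H → EReal} {μ : ℝ} {L : EReal} (hμ : 0 ≤ μ)
    (hf : f ∈ functionClass H μ L) {x y u v : H} (hu : (x, u) ∈ subdifferential f)
    (hv : (y, v) ∈ subdifferential f) :
    μ * ‖x - y‖ ^ 2 ≤ inner ℝ (u - v) (x - y) := by
  obtain ⟨r, hr⟩ := hf.1.exists_real hu
  obtain ⟨s, hs⟩ := hf.1.exists_real hv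
  have h1 := functionClass.add_inner_add_le hμ hf hu hr hs
  have h2 := functionClass.add_inner_add_le hμ hf hv hs hr
  rw [norm_sub_rev y x] at h2
  simp only [inner_sub_left, inner_sub_right] at *
  linarith

/-- The descent lemma. -/
theorem le_add_inner_gradient_add {φ : H → ℝ} {L : ℝ} (hφ : Differentiable ℝ φ)
    (hL : ∀ x y, ‖gradient φ x - gradient φ y‖ ≤ L * ‖x - y‖) (x v : H) :
    φ (x + v) ≤ φ x + inner ℝ (gradient φ x) v + L / 2 * ‖v‖ ^ 2 := by
  set k : ℝ → ℝ := fun t ↦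
    φ (x + t • v) - t * inner ℝ (gradient φ x) v - t ^ 2 * (L / 2 * ‖v‖ ^ 2) with hk
  have hd : ∀ t, HasDerivAt k (inner ℝ (gradient φ (x + t • v)) v - inner ℝ (gradient φ x) v
      - 2 * t * (L / 2 * ‖v‖ ^ 2)) t := by
    intro t
    have h1 : HasDerivAt (fun t : ℝ ↦ x + t • v) v t := by
      simpa using ((hasDerivAt_id t).smul_const v).const_add x
    have h2 := (hφ (x + t • v)).hasGradientAt.hasFDerivAt.comp_hasDerivAt t h1
    have h3 := (hasDerivAt_id t).mul_const (inner ℝ (gradient φ x) v)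
    have h4 := (hasDerivAt_pow 2 t).mul_const (L / 2 * ‖v‖ ^ 2)
    refine ((h2.sub h3).sub h4).congr_deriv ?_
    simp
  have hanti : AntitoneOn k (Set.Icc 0 1) := by
    refine antitoneOn_of_deriv_nonpos (convex_Icc 0 1)
      (fun t _ ↦ (hd t).continuousAt.continuousWithinAt)
      (fun t _ ↦ (hd t).differentiableAt.differentiableWithinAt) fun t ht ↦ ?_
    rw [interior_Icc] at ht
    rw [(hd t).deriv, ← inner_sub_left]
    have h1 := real_inner_le_norm (gradient φ (x + t • v) - gradient φ x) v
    have h2 := hL (x + t • v) x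
    rw [add_sub_cancel_left, norm_smul, Real.norm_of_nonneg ht.1.le] at h2
    have h3 := mul_le_mul_of_nonneg_right h2 (norm_nonneg v)
    linarith
  have := hanti (Set.left_mem_Icc.2 zero_le_one) (Set.right_mem_Icc.2 zero_le_one) zero_le_one
  simp only [hk, one_smul, zero_smul, add_zero] at this
  linarith

theorem eq_gradient_of_mem_subdifferential {f : H → EReal} {φ : H → ℝ} (hφ : ∀ x, f x = φ x)
    {x u : H} (hd : DifferentiableAt ℝ φ x) (hu : (x, u) ∈ subdifferential f) :
    u = gradient φ x := by
  have hmin : IsLocalMin (fun y ↦ φ y - inner ℝ u y) x := by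
    refine Filter.Eventually.of_forall fun y ↦ ?_
    have h := hu y
    simp only [hφ] at h
    norm_cast at h
    rw [inner_sub_right] at h
    linarith
  have h1 : HasFDerivAt (fun y ↦ φ y - inner ℝ u y) _ x :=
    hd.hasGradientAt.hasFDerivAt.sub (innerSL ℝ u).hasFDerivAt
  have h2 := hmin.hasFDerivAt_eq_zero h1
  refine ext_inner_right ℝ fun v ↦ ?_
  have h3 : inner ℝ (gradient φ x) v - inner ℝ u v = 0 := congrArg (fun l : H →L[ℝ] ℝ ↦ l v) h2
  linarith

/-- The interpolation inequality for `μ`-strongly convex, `L`-smooth functions: it is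
cocoercivity of the subdifferential of `f - (μ / 2) ‖·‖ ^ 2`, which is convex and
`(L - μ)`-smooth. -/
theorem functionClass.inSector_of_ne_top {f : H → EReal} {μ : ℝ} {L : EReal} (hμ : 0 ≤ μ)
    (hμL : μ < L) (hL : L ≠ ⊤) (hf : f ∈ functionClass H μ L) {x y u v : H}
    (hu : (x, u) ∈ subdifferential f) (hv : (y, v) ∈ subdifferential f) :
    InSector μ L.toReal (x - y) (u - v) := by
  obtain ⟨φ, hφ, hdiff, hlip⟩ := hf.2.2 hL
  have hM : 0 < L.toReal - μ := by
    rw [← EReal.coe_toReal hL (bot_lt_of_lt hμL).ne'] at hμL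
    linarith [EReal.coe_lt_coe_iff.1 hμL]
  set M := L.toReal - μ with hMdef
  have half : ∀ {x y u v : H}, (x, u) ∈ subdifferential f → (y, v) ∈ subdifferential f →
      φ x + inner ℝ u (y - x) + μ / 2 * ‖y - x‖ ^ 2
        + ‖(v - u) - μ • (y - x)‖ ^ 2 / (2 * M) ≤ φ y := by
    intro x y u v hu hv
    -- `e` minimises the quadratic upper bound at `y` minus the quadratic lower bound at `x`
    set e := (-M⁻¹) • ((v - u) - μ • (y - x)) with he
    have h1 := functionClass.add_inner_add_le hμ hf hu (hφ x) (hφ (y + e))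
    have h2 := le_add_inner_gradient_add hdiff hlip y e
    rw [← eq_gradient_of_mem_subdifferential hφ (hdiff y) hv] at h2
    have hG : (v - u) - μ • (y - x) = (-M) • e := by
      rw [he, smul_smul, neg_mul_neg, mul_inv_cancel₀ hM.ne', one_smul]
    have hG2 : inner ℝ v e - inner ℝ u e - μ * inner ℝ (y - x) e = -M * ‖e‖ ^ 2 := by
      have := congrArg (fun w ↦ inner ℝ w e) hG
      simpa only [inner_sub_left, real_inner_smul_left, real_inner_self_eq_norm_sq, mul_sub]
        using this
    have h3 : ‖x - (y + e)‖ ^ 2 = ‖y - x‖ ^ 2 + 2 * inner ℝ (y - x) e + ‖e‖ ^ 2 := by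
      rw [norm_sub_rev, add_sub_right_comm, norm_add_sq_real]
    have h4 : inner ℝ u (y + e - x) = inner ℝ u (y - x) + inner ℝ u e := by
      rw [add_sub_right_comm, inner_add_right]
    have h5 : ‖(v - u) - μ • (y - x)‖ ^ 2 / (2 * M) = M / 2 * ‖e‖ ^ 2 := by
      rw [hG, norm_smul, mul_pow, norm_neg, Real.norm_of_nonneg hM.le]
      field_simp
    rw [h3, h4] at h1
    rw [h5]
    have hLM : L.toReal = M + μ := by rw [hMdef]; ring
    rw [hLM] at h2
    linarith
  have h1 := half hu hv
  have h2 := half hv hu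
  have hsym : (v - u) - μ • (y - x) = -((u - v) - μ • (x - y)) := by module
  rw [hsym, norm_neg] at h1
  rw [norm_sub_rev y x] at h1
  have h3 : ‖(u - v) - μ • (x - y)‖ ^ 2 ≤ M * inner ℝ ((u - v) - μ • (x - y)) (x - y) := by
    have : ‖(u - v) - μ • (x - y)‖ ^ 2 / (2 * M) * (2 * M) = ‖(u - v) - μ • (x - y)‖ ^ 2 := by
      field_simp
    rw [← this, mul_comm M, ← sub_nonneg]
    have h4 : ‖(u - v) - μ • (x - y)‖ ^ 2 / (2 * M) * 2 ≤
        inner ℝ ((u - v) - μ • (x - y)) (x - y) := by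
      rw [inner_sub_left, real_inner_smul_left, real_inner_self_eq_norm_sq]
      have : inner ℝ (u - v) (x - y) = -(inner ℝ u (y - x) + inner ℝ v (x - y)) := by
        simp only [inner_sub_left, inner_sub_right]; ring
      linarith
    have := mul_le_mul_of_nonneg_right h4 hM.le
    linarith
  have h6 : (u - v) - L.toReal • (x - y) = ((u - v) - μ • (x - y)) - M • (x - y) := by
    rw [hMdef]; module
  rw [InSector, h6, inner_sub_right, real_inner_self_eq_norm_sq, real_inner_smul_right]
  linarith

/-! ### Sectors of resolvents and of the Davis--Yin operator -/

theorem invOneAdd_le {α μ : ℝ} {L : EReal} (hα : 0 < α) (hμ : 0 ≤ μ) (hμL : μ < L) :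
    0 ≤ invOneAdd α L ∧ invOneAdd α L ≤ 1 / (1 + α * μ) := by
  unfold invOneAdd
  split_ifs with h
  · exact ⟨le_rfl, by positivity⟩
  · rw [← EReal.coe_toReal h (bot_lt_of_lt hμL).ne'] at hμL
    have hlt := EReal.coe_lt_coe_iff.1 hμL
    have hL : 0 ≤ L.toReal := hμ.trans hlt.le
    exact ⟨by positivity, by gcongr⟩

theorem functionClass.inSector_resolvent {f : H → EReal} {μ α : ℝ} {L : EReal} (hα : 0 < α)
    (hμ : 0 ≤ μ) (hμL : μ < L) (hf : f ∈ functionClass H μ L) {z z' a a' : H}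
    (ha : (z, a) ∈ MultiOp.resolvent α (subdifferential f))
    (ha' : (z', a') ∈ MultiOp.resolvent α (subdifferential f)) :
    InSector (1 / (1 + α * μ)) (invOneAdd α L) (z - z') (a - a') := by
  obtain ⟨u, hu, rfl⟩ := MultiOp.mem_resolvent.1 ha
  obtain ⟨u', hu', rfl⟩ := MultiOp.mem_resolvent.1 ha'
  have hz : a + α • u - (a' + α • u') = (a - a') + α • (u - u') := by module
  have key : ∀ m : ℝ, 0 ≤ m → (a - a') - (1 / (1 + α * m)) • ((a - a') + α • (u - u')) =
      (-(α / (1 + α * m))) • ((u - u') - m • (a - a')) := by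
    intro m hm
    have : 1 + α * m ≠ 0 := by positivity
    match_scalars <;> field_simp <;> ring
  rw [hz, InSector, key μ hμ]
  unfold invOneAdd
  split_ifs with h
  · have h1 := functionClass.mul_norm_sq_le_inner hμ hf hu hu'
    rw [zero_smul, sub_zero, real_inner_smul_left, inner_sub_left, real_inner_smul_left,
      real_inner_self_eq_norm_sq, neg_mul, neg_nonpos]
    exact mul_nonneg (by positivity) (by linarith)
  · have h1 := functionClass.inSector_of_ne_top hμ hμL h hf hu hu'
    rw [← EReal.coe_toReal h (bot_lt_of_lt hμL).ne'] at hμL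
    have hL : 0 ≤ L.toReal := hμ.trans (EReal.coe_lt_coe_iff.1 hμL).le
    rw [key _ hL, real_inner_smul_left, real_inner_smul_right, ← mul_assoc, neg_mul_neg]
    exact mul_nonpos_of_nonneg_of_nonpos (by positivity) h1

theorem functionClass.exists_inSector_of_mem_dys {f g h : H → EReal} {μ_f μ_g μ_h : ℝ}
    {L_f L_g : EReal} {L_h : ℝ} (hμf : 0 ≤ μ_f) (hμLf : μ_f < L_f) (hμg : 0 ≤ μ_g)
    (hμLg : μ_g < L_g) (hμh : 0 ≤ μ_h) (hμLh : μ_h < L_h) (hf : f ∈ functionClass H μ_f L_f)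
    (hg : g ∈ functionClass H μ_g L_g) (hh : h ∈ functionClass H μ_h L_h) {α lam d : ℝ}
    (hα : 0 < α) (hd : d = max |2 - lam - α * μ_h| |2 - lam - α * L_h|) {x y u v : H}
    (hu : (x, u) ∈ MultiOp.dys (subdifferential f) (subdifferential g) (subdifferential h) α lam)
    (hv : (y, v) ∈ MultiOp.dys (subdifferential f) (subdifferential g) (subdifferential h) α lam) :
    ∃ b s a : H, InSector (1 / (1 + α * μ_g)) (invOneAdd α L_g) (x - y) b ∧
      InSector d (-d) b s ∧
      InSector (1 / (1 + α * μ_f)) (invOneAdd α L_f) (s - ((x - y) - lam • b)) a ∧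
      u - v = ((x - y) - lam • b) + lam • a := by
  have hB : ∀ x b b', (x, b) ∈ MultiOp.resolvent α (subdifferential g) →
      (x, b') ∈ MultiOp.resolvent α (subdifferential g) → b = b' := by
    intro x b b' hb hb'
    have := functionClass.inSector_resolvent hα hμg hμLg hg hb hb'
    rw [sub_self] at this
    exact sub_eq_zero.1 this.eq_zero
  obtain ⟨b, c, a, hb, hc, ha, rfl⟩ := MultiOp.exists_of_mem_dys hB hu
  obtain ⟨b', c', a', hb', hc', ha', rfl⟩ := MultiOp.exists_of_mem_dys hB hv
  have hcc := functionClass.inSector_of_ne_top hμh (EReal.coe_lt_coe_iff.2 hμLh)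
    (EReal.coe_ne_top _) hh hc hc'
  rw [EReal.toReal_coe] at hcc
  refine ⟨b - b', (2 - lam) • (b - b') - α • (c - c'), a - a',
    functionClass.inSector_resolvent hα hμg hμLg hg hb hb', ?_, ?_, by module⟩
  · rw [hd]
    exact hcc.smul_sub_smul hμLh.le hα
  · convert functionClass.inSector_resolvent hα hμf hμLf hf ha ha' using 1
    module

end

theorem theorem1 {H : Type*} [NormedAddCommGroup H] [InnerProductSpace ℝ H] [CompleteSpace H]
    (f g h : H → EReal) (μ_f μ_g μ_h : ℝ) (L_f L_g : EReal) (L_h : ℝ)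
    (hμf : 0 ≤ μ_f) (hμLf : (μ_f : EReal) < L_f)
    (hμg : 0 ≤ μ_g) (hμLg : (μ_g : EReal) < L_g)
    (hμh : 0 ≤ μ_h) (hμLh : μ_h < L_h)
    (hf : f ∈ functionClass H μ_f L_f)
    (hg : g ∈ functionClass H μ_g L_g)
    (hh : h ∈ functionClass H μ_h (L_h : EReal))
    (α lam : ℝ) (hα : 0 < α) (hlam : 0 < lam)
    (C_f C_g R_f R_g d : ℝ)
    (hCf : C_f = 1 / 2 * (1 / (1 + α * μ_f) + invOneAdd α L_f))
    (hCg : C_g = 1 / 2 * (1 / (1 + α * μ_g) + invOneAdd α L_g))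
    (hRf : R_f = 1 / 2 * (1 / (1 + α * μ_f) - invOneAdd α L_f))
    (hRg : R_g = 1 / 2 * (1 / (1 + α * μ_g) - invOneAdd α L_g))
    (hd : d = max |2 - lam - α * μ_h| |2 - lam - α * L_h|) :
    (lam < 1 / C_f →
      ∃ ρ_f : ℝ, 0 ≤ ρ_f ∧
        ρ_f ^ 2 = (1 - lam * ((C_f ^ 2 - R_f ^ 2) / C_f)) *
          max
            ((1 - lam * (1 / (1 + α * μ_g))) ^ 2 +
              lam * d ^ 2 / (1 / C_f - lam) * (1 / (1 + α * μ_g)) ^ 2)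
            ((1 - lam * invOneAdd α L_g) ^ 2 +
              lam * d ^ 2 / (1 / C_f - lam) * (invOneAdd α L_g) ^ 2) ∧
        MultiOp.IsLipschitz ρ_f
          (MultiOp.dys (subdifferential f) (subdifferential g) (subdifferential h) α lam)) ∧
    (lam < 1 / C_g →
      ∃ ρ_g : ℝ, 0 ≤ ρ_g ∧
        ρ_g ^ 2 = (1 - lam * ((C_g ^ 2 - R_g ^ 2) / C_g)) *
          max
            ((1 - lam * (1 / (1 + α * μ_f))) ^ 2 +
              lam * d ^ 2 / (1 / C_g - lam) * (1 / (1 + α * μ_f)) ^ 2)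
            ((1 - lam * invOneAdd α L_f) ^ 2 +
              lam * d ^ 2 / (1 / C_g - lam) * (invOneAdd α L_f) ^ 2) ∧
        MultiOp.IsLipschitz ρ_g
          (MultiOp.dys (subdifferential f) (subdifferential g) (subdifferential h) α lam)) := by
  obtain ⟨hqf, hqpf⟩ := invOneAdd_le hα hμf hμLf
  obtain ⟨hqg, hqpg⟩ := invOneAdd_le hα hμg hμLg
  have hpf : 0 < 1 / (1 + α * μ_f) := by positivity
  have hpg : 0 < 1 / (1 + α * μ_g) := by positivity
  have hd0 : 0 ≤ d := hd ▸ le_max_of_le_left (abs_nonneg _)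
  have hdys := fun x y u v : H ↦ functionClass.exists_inSector_of_mem_dys hμf hμLf hμg hμLg hμh
    hμLh hf hg hh hα hd (x := x) (y := y) (u := u) (v := v)
  have hCRf : C_f ^ 2 - R_f ^ 2 = 1 / (1 + α * μ_f) * invOneAdd α L_f := by rw [hCf, hRf]; ring
  have hCRg : C_g ^ 2 - R_g ^ 2 = 1 / (1 + α * μ_g) * invOneAdd α L_g := by rw [hCg, hRg]; ring
  have hCf' : C_f = (1 / (1 + α * μ_f) + invOneAdd α L_f) / 2 := by rw [hCf]; ring
  have hCg' : C_g = (1 / (1 + α * μ_g) + invOneAdd α L_g) / 2 := by rw [hCg]; ring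
  rw [hCRf, hCRg, hCf', hCg']
  refine ⟨fun hl ↦ ?_, fun hl ↦ ?_⟩
  · refine MultiOp.exists_isLipschitz_of_sq_le
      (rateSq_nonneg (add_pos_of_pos_of_nonneg hpf hqf) hlam hl) fun x y u v hu hv ↦ ?_
    obtain ⟨b, s, a, hb, hs, ha, he⟩ := hdys x y u v hu hv
    rw [he]
    exact norm_sq_le_rateSq (add_pos_of_pos_of_nonneg hpf hqf) hqpg hd0 hlam hl hb hs ha
  · refine MultiOp.exists_isLipschitz_of_sq_le
      (rateSq_nonneg (add_pos_of_pos_of_nonneg hpg hqg) hlam hl) fun x y u v hu hv ↦ ?_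
    obtain ⟨b, s, a, hb, hs, ha, he⟩ := hdys x y u v hu hv
    rw [he]
    exact norm_sq_le_rateSq_swap hqpf (add_pos_of_pos_of_nonneg hpg hqg) hd0 hlam hl hb hs ha
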